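/- Let $E$ be a finite set of agents and $f:2^E\to\mathbb{R}_{\ge 0}$ the rank function of a polymatroid ($f(\emptyset)=0$, $f$ monotone and submodular). For a set function $h$ put $\mathcal{P}(h)=\{x\in\mathbb{R}_{\ge0}^E : x(A)\le h(A)\ \forall A\subseteq E\}$ and $\mathcal{B}(h)=\{x\in\mathcal{P}(h): x(E)=h(E)\}$. Let $\varepsilon>0$, $K\ge 1$, $V=(1+\varepsilon)^K$. Partition $[1,V]$ into the buckets $I_k=[(1+\varepsilon)^{k-1},(1+\varepsilon)^{k})$, $1\le k\le K$, the last one also containing $V$, and let bucket $I_k$ have a canonical value $m_k$, where $0<m_1<\dots<m_K$ (for instance $m_k\in I_k$). The values $v_i$ of the agents are independent, $v_i\sim D_i$, where $D_i$ is a probability measure supported on $[1,V]$. A mapping rule consists, for each agent $i$, of a signal space and a Markov kernel from values to signals; given the values, the signals $\sigma_i$ are drawn independently. The posterior mean $\mu_i$ is the mean of the conditional law of $v_i$ given $\sigma_i$. Given posterior means $\mu$, let $\mathcal{X}(\mu)$ be the set of $x\in\mathcal{P}(f)$ that maximize $\sum_i\mu_i'x_i$, where $\mu'_i=m_j$ if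 $\mu_i\in I_j$. A selection rule is a measurable map that assigns to every signal profile (almost surely) an allocation $x\in\mathcal{X}(\mu)$. The fake utility of agent $i$ for bucket $k$ is $\hat U_{i,k}=m_kx_i$ if $\mu_i\in I_k$, and $0$ otherwise. For $S\subseteq E$ let $\hat g_k(S;\mu)=\sup_{x\in\mathcal{X}(\mu)}\sum_{i\in S}\hat U_{i,k}$. Fix mapping rules $\Delta=(\Delta_1,\dots,\Delta_K)$. Let $\mathcal{U}$ be the set of all vectors $(\hat U_i)_{i\in E}$, $\hat U_i=\frac1K\sum_{k=1}^K\mathbb{E}_{\mu\sim\Delta_k}[\hat U_{i,k}]$, obtained by varying the selection rules used for $\Delta_1,\dots,\Delta_K$. Let $\rho(S)=\frac1K\sum_{k=1}^K\mathbb{E}_{\mu\sim\Delta_k}[\hat g_k(S;\mu)]$ and $$\hat{\mathcal{R}}(\Delta)=\mathcal{P}(\rho)=\Big\{y\ge0:\ \sum_{i\in S}y_i\le\rho(S)\ \ \forall S\subseteq E\Big\}.$$ Then: 1. For every $k$ and every $\mu\in[1,V]^E$, the supremum defining $\hat g_k(S;\mu)$ is attained, and $\hat g_k(S;\mu)=m_k\big(f(P_{>k}\cup(S\cap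 E'_k))-f(P_{>k})\big)$, where $E'_k=\{i:\mu_i\in I_k\}$ and $P_{>k}=\bigcup_{j>k}E'_j$. The function $\hat g_k(\cdot;\mu)$ is nonnegative, monotone and submodular, and vanishes on $\emptyset$. 2. Under each $\Delta_k$ the posterior means lie in $[1,V]$ almost surely, and all the expectations above are expectations of integrable random variables. 3. $\rho$ is nonnegative, monotone and submodular with $\rho(\emptyset)=0$, so $\hat{\mathcal{R}}(\Delta)$ is a polymatroid, and $$\mathcal{B}(\rho)\subseteq\mathcal{U}\subseteq\hat{\mathcal{R}}(\Delta).$$ -/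

import Mathlib

open MeasureTheory ProbabilityTheory

universe u v

namespace Persuasion

/-- `f` is the rank function of a polymatroid on the finite ground set `E`. -/
structure IsPolymatroidRank {E : Type u} [DecidableEq E] (f : Finset E → ℝ) : Prop where
  nonneg : ∀ A, 0 ≤ f A
  empty : f ∅ = 0
  mono : ∀ A B, A ⊆ B → f A ≤ f B
  submodular : ∀ A B, f (A ∪ B) + f (A ∩ B) ≤ f A + f B

/-- The independence polytope of `f`, a subset of the nonnegative orthant. -/
def independencePolytope {E : Type u} (f : Finset E → ℝ) : Set (E → ℝ) :=
  {x | (∀ i, 0 ≤ x i) ∧ ∀ A : Finset E, ∑ i ∈ A, x i ≤ f A}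

/-- The base polytope of `f`. -/
def basePolytope {E : Type u} [Fintype E] (f : Finset E → ℝ) : Set (E → ℝ) :=
  {x | x ∈ independencePolytope f ∧ ∑ i, x i = f Finset.univ}

/-- The face of allocations in the independence polytope of `f` that maximize the welfare
`∑ i, w i * x i`. -/
def optimalFace {E : Type u} [Fintype E] (f : Finset E → ℝ) (w : E → ℝ) : Set (E → ℝ) :=
  {x | x ∈ independencePolytope f ∧
    ∀ y ∈ independencePolytope f, ∑ i, w i * y i ≤ ∑ i, w i * x i}

/-- The buckets of `[1, V]` for `V = (1 + ε) ^ K`, indexed from `0`: bucket `k` is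
`[(1 + ε) ^ k, (1 + ε) ^ (k + 1))`, and the last one also contains its right end point `V`,
so that the buckets partition `[1, V]`. -/
def bucket (ε V : ℝ) {K : ℕ} (k : Fin K) : Set ℝ :=
  {t | (1 + ε) ^ (k : ℕ) ≤ t ∧
    (t < (1 + ε) ^ ((k : ℕ) + 1) ∨ ((k : ℕ) + 1 = K ∧ t = V))}

/-- The canonical value of a posterior mean `t`: it is `m k` if `t` lies in bucket `k`
(the buckets are disjoint), and `0` if `t` lies in no bucket, that is outside `[1, V]`. -/
noncomputable def canonicalValue (ε V : ℝ) {K : ℕ} (m : Fin K → ℝ) (t : ℝ) : ℝ :=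
  ∑ k, (bucket ε V k).indicator (fun _ => m k) t

/-- The allocations open to the receiver when the posterior means are `μ`: the welfare-optimal
face for the vector of canonical values. -/
def receiverAllocations {E : Type u} [Fintype E] (f : Finset E → ℝ) (ε V : ℝ) {K : ℕ}
    (m : Fin K → ℝ) (μ : E → ℝ) : Set (E → ℝ) :=
  optimalFace f (fun i => canonicalValue ε V m (μ i))

open Classical in
/-- The fake utility of agent `i` restricted to bucket `k`, at posterior means `μ` and
allocation `x`. -/
noncomputable def fakeUtility {E : Type u} (ε V : ℝ) {K : ℕ} (m : Fin K → ℝ) (k : Fin K)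
    (μ x : E → ℝ) (i : E) : ℝ :=
  if μ i ∈ bucket ε V k then m k * x i else 0

/-- The maximum total fake utility (restricted to bucket `k`) of the agents in `S` at posterior
means `μ`, over all choices of the receiver among welfare-optimal allocations. -/
noncomputable def gHat {E : Type u} [Fintype E] (f : Finset E → ℝ) (ε V : ℝ) {K : ℕ}
    (m : Fin K → ℝ) (k : Fin K) (μ : E → ℝ) (S : Finset E) : ℝ :=
  sSup ((fun x : E → ℝ => ∑ i ∈ S, fakeUtility ε V m k μ x i) ''
    receiverAllocations f ε V m μ)

open Classical in
/-- The agents whose posterior mean lies in bucket `k`. -/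
noncomputable def agentsIn {E : Type u} [Fintype E] (ε V : ℝ) {K : ℕ} (μ : E → ℝ)
    (k : Fin K) : Finset E :=
  Finset.univ.filter (fun i => μ i ∈ bucket ε V k)

open Classical in
/-- The agents whose posterior mean lies in a bucket higher than `k`. -/
noncomputable def agentsAbove {E : Type u} [Fintype E] (ε V : ℝ) {K : ℕ} (μ : E → ℝ)
    (k : Fin K) : Finset E :=
  Finset.univ.filter (fun i => ∃ j : Fin K, k < j ∧ μ i ∈ bucket ε V j)

/-- A mapping rule: for each agent a space of signals, and a Markov kernel sending the value of
the agent to a distribution over the signals of the agent. -/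
structure MappingRule (E : Type u) where
  Signal : E → Type v
  [measurableSpace : ∀ i, MeasurableSpace (Signal i)]
  kernel : ∀ i, Kernel ℝ (Signal i)
  [isMarkovKernel : ∀ i, IsMarkovKernel (kernel i)]

attribute [instance] MappingRule.measurableSpace MappingRule.isMarkovKernel

namespace MappingRule

variable {E : Type u} (Δ : MappingRule.{u, v} E) (D : E → Measure ℝ)

/-- The law of the signal profile: the values are independent with laws `D i`, and each agent's
signal is drawn independently from that agent's kernel at that agent's value. -/
noncomputable def signalLaw [Fintype E] : Measure (∀ i, Δ.Signal i) :=
  Measure.pi (fun i => (D i).bind (Δ.kernel i))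

/-- The vector of posterior means given the signal profile `σ`; `posterior` is the Bayesian
inverse of the kernel with respect to the prior `D i`. -/
noncomputable def posteriorMean [∀ i, IsFiniteMeasure (D i)] (σ : ∀ i, Δ.Signal i) : E → ℝ :=
  fun i => ∫ t, t ∂(posterior (Δ.kernel i) (D i) (σ i))

/-- A selection rule for the receiver: a measurable choice, for every signal profile, of an
allocation that is welfare-optimal for the canonical values of the posterior means. As these
are determined by the signals only almost surely, so is the requirement. -/
def IsSelectionRule [Fintype E] [∀ i, IsFiniteMeasure (D i)] (f : Finset E → ℝ) (ε V : ℝ)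
    {K : ℕ} (m : Fin K → ℝ) (x : (∀ i, Δ.Signal i) → E → ℝ) : Prop :=
  Measurable x ∧
    ∀ᵐ σ ∂(Δ.signalLaw D), x σ ∈ receiverAllocations f ε V m (Δ.posteriorMean D σ)

end MappingRule

section Randomized

variable {E : Type u} [Fintype E] {K : ℕ} (Δ : Fin K → MappingRule.{u, v} E)
  (D : E → Measure ℝ) [∀ i, IsFiniteMeasure (D i)] (f : Finset E → ℝ) (ε V : ℝ) (m : Fin K → ℝ)

/-- The expected fake utility vector of the randomized single-mean policy that picks one of the
`K` buckets uniformly at random and, for bucket `k`, uses the mapping rule `Δ k` and the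
selection rule `x k`. -/
noncomputable def expectedFakeUtility (x : ∀ k, (∀ i, (Δ k).Signal i) → E → ℝ) : E → ℝ :=
  fun i => (1 / (K : ℝ)) * ∑ k,
    ∫ σ, fakeUtility ε V m k ((Δ k).posteriorMean D σ) (x k σ) i ∂((Δ k).signalLaw D)

/-- The expected fake utility vectors obtained from the mapping rule `Δ` by varying the selection
rule of the receiver. -/
def achievableFakeUtilities : Set (E → ℝ) :=
  {u | ∃ x : ∀ k, (∀ i, (Δ k).Signal i) → E → ℝ,
    (∀ k, (Δ k).IsSelectionRule D f ε V m (x k)) ∧ u = expectedFakeUtility Δ D ε V m x}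

/-- The set function `S ↦ (1 / K) ∑ k, 𝔼[gHat k μ S]`, with `μ` the posterior means produced
by `Δ k`. -/
noncomputable def rankHat (S : Finset E) : ℝ :=
  (1 / (K : ℝ)) * ∑ k,
    ∫ σ, gHat f ε V m k ((Δ k).posteriorMean D σ) S ∂((Δ k).signalLaw D)

end Randomized

end Persuasion

/-! Everything rests on Edmonds' greedy algorithm. For an ordering of the agents, the vector of
marginal contributions lies in the independence polytope and maximizes any nonnegative weight
decreasing along the ordering (`sum_mul_le_sum_mul_greedy`). Every optimal allocation is tight on
the superlevel sets of the weights, so what remains for the agents of weight `c` is governed by `f`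
contracted by the strictly heavier agents (`faceRank`). This bounds their fake utility. Breaking
ties so that `S` comes first attains the bound, which gives the closed form of `gHat`
(`isGreatest_faceRank`).

The upper inclusion is that pointwise bound, integrated. For the lower one, fix one tie-breaking
order `q` for all signal profiles. The fake utilities for bucket `k` are then the greedy vector of
`gHat` in the order `q` (`ite_mul_greedy_weightRank`). Greedy vectors are linear in the set
function, so averaging makes the greedy vector of `rankHat` achievable. The base polytope lies in
the convex hull of the greedy vectors, and the achievable set is convex because selection rules can
be mixed pointwise. -/

namespace Persuasion

/-! ### Greedy vectors and their optimality -/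

section Greedy

variable {E : Type u} [Fintype E] {α : Type*} [LinearOrder α]

/-- The greedy vector of a set function `f` for the ranking `r` of the agents: agent `i` receives
the marginal contribution of `i` to the set of the agents ranked before `i`. -/
def greedy (f : Finset E → ℝ) (r : E → α) (i : E) : ℝ :=
  f (Finset.univ.filter (fun j => r j ≤ r i)) - f (Finset.univ.filter (fun j => r j < r i))

theorem greedy_congr {β : Type*} [LinearOrder β] (f : Finset E → ℝ) {r : E → α} {s : E → β}
    (h : ∀ i j, r i < r j ↔ s i < s j) : greedy f r = greedy f s := by
  have h' : ∀ i j, r i ≤ r j ↔ s i ≤ s j := fun i j => by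
    rw [← not_lt, ← not_lt, h]
  funext i
  simp [greedy, h, h']

variable [DecidableEq E]

/-- A lower set of a ranking, with its last agent `a` removed, consists of the agents ranked
before `a`. -/
theorem eq_filter_of_isLower_insert {r : E → α} (hr : Function.Injective r) {a : E}
    {s : Finset E} (ha : a ∉ s) (hmax : ∀ x ∈ s, r x ≤ r a)
    (hL : ∀ i ∈ insert a s, ∀ j, r j ≤ r i → j ∈ insert a s) :
    s = Finset.univ.filter (fun j => r j < r a) ∧
      insert a s = Finset.univ.filter (fun j => r j ≤ r a) ∧
      ∀ i ∈ s, ∀ j, r j ≤ r i → j ∈ s := by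
  have hlt : ∀ x ∈ s, r x < r a := fun x hx =>
    lt_of_le_of_ne (hmax x hx) (fun h => ha (hr h ▸ hx))
  have hs : s = Finset.univ.filter (fun j => r j < r a) := by
    ext j
    simp only [Finset.mem_filter, Finset.mem_univ, true_and]
    refine ⟨hlt j, fun h => ?_⟩
    rcases Finset.mem_insert.1 (hL a (Finset.mem_insert_self a s) j h.le) with rfl | h'
    · exact absurd h (lt_irrefl _)
    · exact h'
  refine ⟨hs, ?_, ?_⟩
  · ext j
    simp only [Finset.mem_filter, Finset.mem_univ, true_and]
    refine ⟨fun h => ?_, fun h => hL a (Finset.mem_insert_self a s) j h⟩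
    rcases Finset.mem_insert.1 h with rfl | h'
    · exact le_rfl
    · exact hmax j h'
  · intro i hi j hj
    rw [hs]
    simpa using hj.trans_lt (hlt i hi)

/-- The marginal contributions telescope as the agents of `L` are removed from the last ranked to
the first. -/
theorem sum_greedy_of_isLower {f : Finset E → ℝ} (hf : f ∅ = 0) {r : E → α}
    (hr : Function.Injective r) (L : Finset E) (hL : ∀ i ∈ L, ∀ j, r j ≤ r i → j ∈ L) :
    ∑ i ∈ L, greedy f r i = f L := by
  induction L using Finset.induction_on_max_value r with
  | empty => simp [hf]
  | insert a s ha hmax ih =>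
    obtain ⟨h1, h2, h3⟩ := eq_filter_of_isLower_insert hr ha hmax hL
    rw [Finset.sum_insert ha, ih h3, greedy, ← h1, ← h2]
    ring

/-- Diminishing returns: the last agent of `A` adds at least as much to the rest of `A` as to the
set of all its predecessors. -/
theorem sum_greedy_le {f : Finset E → ℝ} (hf : IsPolymatroidRank f) {r : E → α}
    (hr : Function.Injective r) (A : Finset E) : ∑ i ∈ A, greedy f r i ≤ f A := by
  induction A using Finset.induction_on_max_value r with
  | empty => simp [hf.empty]
  | insert a s ha hmax ih =>
    have hlt : ∀ x ∈ s, r x < r a := fun x hx =>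
      lt_of_le_of_ne (hmax x hx) (fun h => ha (hr h ▸ hx))
    have hsub := hf.submodular (insert a s) (Finset.univ.filter (fun j => r j < r a))
    have h1 : insert a s ∪ Finset.univ.filter (fun j => r j < r a)
        = Finset.univ.filter (fun j => r j ≤ r a) := by
      ext j
      simp only [Finset.mem_union, Finset.mem_insert, Finset.mem_filter, Finset.mem_univ, true_and]
      refine ⟨?_, fun h => ?_⟩
      · rintro ((rfl | h) | h)
        exacts [le_rfl, hmax j h, h.le]
      · rcases h.lt_or_eq with h | h
        exacts [Or.inr h, Or.inl (Or.inl (hr h))]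
    have h2 : insert a s ∩ Finset.univ.filter (fun j => r j < r a) = s := by
      ext j
      simp only [Finset.mem_inter, Finset.mem_insert, Finset.mem_filter, Finset.mem_univ, true_and]
      refine ⟨?_, fun h => ⟨Or.inr h, hlt j h⟩⟩
      rintro ⟨rfl | h, h'⟩
      exacts [absurd h' (lt_irrefl _), h]
    rw [h1, h2] at hsub
    rw [Finset.sum_insert ha, greedy]
    linarith

theorem greedy_mem_independencePolytope {f : Finset E → ℝ} (hf : IsPolymatroidRank f)
    {r : E → α} (hr : Function.Injective r) : greedy f r ∈ independencePolytope f := by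
  refine ⟨fun i => sub_nonneg.2 (hf.mono _ _ ?_), sum_greedy_le hf hr⟩
  exact Finset.monotone_filter_right _ (fun j _ h => h.le)

/-- Abel summation: if `d` has nonnegative sums over the lower sets of a ranking along which the
weights `w` decrease, then over a lower set the `w`-weighted sum of `d` is at least the sum of `d`
times any lower bound of `w`. -/
theorem mul_sum_le_sum_mul_of_isLower {w d : E → ℝ} {r : E → α} (hr : Function.Injective r)
    (hw : ∀ i j, r i < r j → w j ≤ w i)
    (hd : ∀ A : Finset E, (∀ i ∈ A, ∀ j, r j ≤ r i → j ∈ A) → 0 ≤ ∑ i ∈ A, d i)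
    (L : Finset E) (hL : ∀ i ∈ L, ∀ j, r j ≤ r i → j ∈ L) (c : ℝ) (hc : ∀ i ∈ L, c ≤ w i) :
    c * ∑ i ∈ L, d i ≤ ∑ i ∈ L, w i * d i := by
  induction L using Finset.induction_on_max_value r generalizing c with
  | empty => simp
  | insert a s ha hmax ih =>
    have h3 := (eq_filter_of_isLower_insert hr ha hmax hL).2.2
    have h4 := ih h3 (w a) fun i hi =>
      hw i a (lt_of_le_of_ne (hmax i hi) (fun h => ha (hr h ▸ hi)))
    have h5 := mul_le_mul_of_nonneg_right (hc a (Finset.mem_insert_self a s)) (hd _ hL)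
    rw [Finset.sum_insert ha] at h5 ⊢
    rw [Finset.sum_insert ha]
    linarith [mul_add (w a) (d a) (∑ i ∈ s, d i)]

/-- Abel summation applied to the difference of the greedy vector and `x`. The lower bound on the
weights is 0 if they are nonnegative; if `x` has full total, the difference sums to zero and any
lower bound serves, whatever the signs. -/
theorem sum_mul_le_sum_mul_greedy {f : Finset E → ℝ} (hf : f ∅ = 0) {w : E → ℝ}
    {r : E → α} (hr : Function.Injective r) (hw : ∀ i j, r i < r j → w j ≤ w i) {x : E → ℝ}
    (hx : ∀ A : Finset E, ∑ i ∈ A, x i ≤ f A)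
    (h : (∀ i, 0 ≤ w i) ∨ ∑ i, x i = f Finset.univ) :
    ∑ i, w i * x i ≤ ∑ i, w i * greedy f r i := by
  have hd : ∀ A : Finset E, (∀ i ∈ A, ∀ j, r j ≤ r i → j ∈ A) →
      0 ≤ ∑ i ∈ A, (greedy f r i - x i) := fun A hA => by
    rw [Finset.sum_sub_distrib, sum_greedy_of_isLower hf hr A hA]
    exact sub_nonneg.2 (hx A)
  have key := mul_sum_le_sum_mul_of_isLower hr hw hd Finset.univ (by simp)
  have hsub : ∑ i, w i * (greedy f r i - x i) = ∑ i, w i * greedy f r i - ∑ i, w i * x i := by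
    simp [mul_sub]
  rw [hsub] at key
  rcases h with h | h
  · linarith [key 0 fun i _ => h i]
  · obtain ⟨c, hc⟩ : ∃ c, ∀ i, c ≤ w i := by
      obtain ⟨c, hc⟩ := (Set.finite_range w).bddBelow
      exact ⟨c, fun i => hc (Set.mem_range_self i)⟩
    have h0 : ∑ i, (greedy f r i - x i) = 0 := by
      rw [Finset.sum_sub_distrib, sum_greedy_of_isLower hf hr _ (by simp), h, sub_self]
    have := key c fun i _ => hc i
    rw [h0, mul_zero] at this
    linarith

end Greedy

/-! ### Rankings by weight with tie-breaking -/

section WeightRank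

variable {E : Type u} {β : Type*}

/-- The ranking of the agents by decreasing weight, with ties broken by the ranking `q`. -/
def weightRank (w : E → ℝ) (q : E → β) (i : E) : ℝ ×ₗ β := toLex (-w i, q i)

theorem weightRank_injective (w : E → ℝ) {q : E → β} (hq : Function.Injective q) :
    Function.Injective (weightRank w q) := fun _ _ h =>
  hq (Prod.ext_iff.1 (toLex.injective h)).2

variable [LinearOrder β]

theorem weightRank_lt_iff {w : E → ℝ} {q : E → β} {i j : E} :
    weightRank w q i < weightRank w q j ↔ w j < w i ∨ w i = w j ∧ q i < q j := by
  simp [weightRank, Prod.Lex.toLex_lt_toLex]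

theorem weightRank_le_iff {w : E → ℝ} {q : E → β} {i j : E} :
    weightRank w q i ≤ weightRank w q j ↔ w j < w i ∨ w i = w j ∧ q i ≤ q j := by
  simp [weightRank, Prod.Lex.toLex_le_toLex]

theorem weight_le_of_weightRank_le {w : E → ℝ} {q : E → β} {i j : E}
    (h : weightRank w q i ≤ weightRank w q j) : w j ≤ w i := by
  rcases weightRank_le_iff.1 h with h | h
  exacts [h.le, h.1.ge]

end WeightRank

/-! ### Structure of the welfare-optimal face -/

section Face

variable {E : Type u} [Fintype E] {β : Type*} [LinearOrder β] [DecidableEq E]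

theorem greedy_mem_optimalFace {f : Finset E → ℝ} (hf : IsPolymatroidRank f) {w : E → ℝ}
    (hw : ∀ i, 0 ≤ w i) {q : E → β} (hq : Function.Injective q) :
    greedy f (weightRank w q) ∈ optimalFace f w :=
  ⟨greedy_mem_independencePolytope hf (weightRank_injective w hq), fun _ hy =>
    sum_mul_le_sum_mul_greedy hf.empty (weightRank_injective w hq)
      (fun _ _ h => weight_le_of_weightRank_le h.le) hy.2 (Or.inl hw)⟩

/-- A welfare-optimal allocation is tight on the superlevel sets of the weights. -/
theorem sum_superlevel_of_mem_optimalFace {f : Finset E → ℝ} (hf : IsPolymatroidRank f)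
    {w : E → ℝ} (hw : ∀ i, 0 ≤ w i) {x : E → ℝ} (hx : x ∈ optimalFace f w) {c : ℝ}
    (hc : 0 ≤ c) :
    ∑ i ∈ Finset.univ.filter (fun i => c < w i), x i
      = f (Finset.univ.filter (fun i => c < w i)) := by
  set T := Finset.univ.filter (fun i => c < w i) with hT
  have hmemT : ∀ i, i ∈ T ↔ c < w i := fun i => by simp [hT]
  -- `δ` is at most the gap between `c` and the weights above it, so lowering the weights on `T` by
  -- `δ` preserves their order and sign.
  obtain ⟨δ, hδ, hδw⟩ : ∃ δ > 0, ∀ i ∈ T, c + δ ≤ w i := by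
    rcases T.eq_empty_or_nonempty with h | h
    · exact ⟨1, one_pos, by simp [h]⟩
    · obtain ⟨i, hi, hmin⟩ := T.exists_min_image w h
      exact ⟨w i - c, sub_pos.2 ((hmemT i).1 hi), fun j hj => by linarith [hmin j hj]⟩
  let q := Fintype.equivFin E
  have hr := weightRank_injective w q.injective
  have hopt := greedy_mem_optimalFace hf hw q.injective
  have hle := hopt.2 x hx.1
  have hge := hx.2 _ hopt.1
  have hgT : ∑ i ∈ T, greedy f (weightRank w q) i = f T :=
    sum_greedy_of_isLower hf.empty hr T fun i hi j hj =>
      (hmemT j).2 (((hmemT i).1 hi).trans_le (weight_le_of_weightRank_le hj))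
  -- The same greedy vector is optimal for the lowered weights. Since `x` ties with it for `w`, it
  -- can lose no less than the greedy vector does on `T`.
  have hlow := sum_mul_le_sum_mul_greedy (w := fun i => w i - if i ∈ T then δ else 0)
    hf.empty hr (fun i j hij => by
      have h1 := weight_le_of_weightRank_le hij.le
      by_cases hi : i ∈ T <;> by_cases hj : j ∈ T <;> simp only [hi, hj, if_true, if_false]
      · linarith
      · have := hδw i hi
        have := not_lt.1 fun h => hj ((hmemT j).2 h)
        linarith
      · exact absurd ((hmemT i).2 (((hmemT j).1 hj).trans_le h1)) hi
      · linarith) hx.1.2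
    (Or.inl fun i => by
      by_cases hi : i ∈ T <;> simp only [hi, if_true, if_false]
      · linarith [hδw i hi]
      · linarith [hw i])
  have hsplit : ∀ y : E → ℝ, ∑ i, (w i - if i ∈ T then δ else 0) * y i
      = ∑ i, w i * y i - δ * ∑ i ∈ T, y i := fun y => by
    simp [sub_mul, ite_mul, Finset.mul_sum]
  rw [hsplit, hsplit, hgT] at hlow
  have hxT := hx.1.2 T
  have : δ * f T ≤ δ * ∑ i ∈ T, x i := by linarith
  exact le_antisymm hxT (le_of_mul_le_mul_left this hδ)

/-- The rank function of the agents of weight `c` in the face of the welfare-optimal allocations,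
scaled by `c`. -/
noncomputable def faceRank (f : Finset E → ℝ) (w : E → ℝ) (c : ℝ) (S : Finset E) : ℝ :=
  c * (f (Finset.univ.filter (fun i => c < w i) ∪ (S ∩ Finset.univ.filter (fun i => w i = c)))
    - f (Finset.univ.filter (fun i => c < w i)))

theorem isPolymatroidRank_faceRank {f : Finset E → ℝ} (hf : IsPolymatroidRank f) (w : E → ℝ)
    {c : ℝ} (hc : 0 ≤ c) : IsPolymatroidRank (faceRank f w c) where
  nonneg A := mul_nonneg hc (sub_nonneg.2 (hf.mono _ _ Finset.subset_union_left))
  empty := by simp [faceRank]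
  mono A B h := by
    refine mul_le_mul_of_nonneg_left (sub_le_sub_right (hf.mono _ _ ?_) _) hc
    exact Finset.union_subset_union_right (Finset.inter_subset_inter_right h)
  submodular A B := by
    simp only [faceRank]
    set T := Finset.univ.filter (fun i => c < w i)
    set L := Finset.univ.filter (fun i => w i = c)
    have h := hf.submodular (T ∪ (A ∩ L)) (T ∪ (B ∩ L))
    have h1 : (T ∪ (A ∩ L)) ∪ (T ∪ (B ∩ L)) = T ∪ ((A ∪ B) ∩ L) := by
      ext i; simp only [Finset.mem_union, Finset.mem_inter]; tauto
    have h2 : (T ∪ (A ∩ L)) ∩ (T ∪ (B ∩ L)) = T ∪ ((A ∩ B) ∩ L) := by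
      ext i; simp only [Finset.mem_union, Finset.mem_inter]; tauto
    rw [h1, h2] at h
    have := mul_le_mul_of_nonneg_left h hc
    linarith [mul_add c (f (T ∪ ((A ∪ B) ∩ L))) (f (T ∪ ((A ∩ B) ∩ L))),
      mul_add c (f (T ∪ (A ∩ L))) (f (T ∪ (B ∩ L))), mul_sub c (f (T ∪ (A ∩ L))) (f T),
      mul_sub c (f (T ∪ (B ∩ L))) (f T), mul_sub c (f (T ∪ ((A ∪ B) ∩ L))) (f T),
      mul_sub c (f (T ∪ ((A ∩ B) ∩ L))) (f T)]

/-- Subtract the tight constraint on the agents heavier than `c` from the constraint on their union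
with the agents of `S` of weight `c`. -/
theorem sum_ite_le_faceRank {f : Finset E → ℝ} (hf : IsPolymatroidRank f) {w : E → ℝ}
    (hw : ∀ i, 0 ≤ w i) {x : E → ℝ} (hx : x ∈ optimalFace f w) {c : ℝ} (hc : 0 ≤ c)
    (S : Finset E) : ∑ i ∈ S, (if w i = c then c * x i else 0) ≤ faceRank f w c S := by
  have h1 := sum_superlevel_of_mem_optimalFace hf hw hx hc
  have h2 := hx.1.2 (Finset.univ.filter (fun i => c < w i) ∪
    (S ∩ Finset.univ.filter (fun i => w i = c)))
  rw [Finset.sum_union, h1] at h2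
  · rw [faceRank, ← Finset.sum_filter, ← Finset.mul_sum]
    refine mul_le_mul_of_nonneg_left ?_ hc
    have h3 : S ∩ Finset.univ.filter (fun i => w i = c) = S.filter (fun i => w i = c) := by
      ext i; simp
    rw [h3] at h2 ⊢
    linarith
  · rw [Finset.disjoint_left]
    intro i hi hi'
    simp only [Finset.mem_filter, Finset.mem_inter, Finset.mem_univ, true_and] at hi hi'
    exact hi.ne' hi'.2

/-- Restricted to the agents of weight `c`, the greedy allocation is the greedy vector of
`faceRank`. -/
theorem ite_mul_greedy_weightRank (f : Finset E → ℝ) (w : E → ℝ) {q : E → β}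
    (hq : Function.Injective q) (c : ℝ) (i : E) :
    (if w i = c then c * greedy f (weightRank w q) i else 0) = greedy (faceRank f w c) q i := by
  split_ifs with h
  · have h1 : Finset.univ.filter (fun j => weightRank w q j ≤ weightRank w q i)
        = Finset.univ.filter (fun i => c < w i) ∪
          (Finset.univ.filter (fun j => q j ≤ q i) ∩ Finset.univ.filter (fun i => w i = c)) := by
      ext j; simp [weightRank_le_iff, h, and_comm]
    have h2 : Finset.univ.filter (fun j => weightRank w q j < weightRank w q i)
        = Finset.univ.filter (fun i => c < w i) ∪
          (Finset.univ.filter (fun j => q j < q i) ∩ Finset.univ.filter (fun i => w i = c)) := by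
      ext j; simp [weightRank_lt_iff, h, and_comm]
    rw [greedy, greedy, h1, h2, faceRank, faceRank]
    ring
  -- An agent of another weight is a loop of `faceRank`: adding it leaves the trace on the agents of
  -- weight `c` unchanged.
  · have : Finset.univ.filter (fun j => q j ≤ q i) ∩ Finset.univ.filter (fun i => w i = c)
        = Finset.univ.filter (fun j => q j < q i) ∩ Finset.univ.filter (fun i => w i = c) := by
      ext j
      simp only [Finset.mem_inter, Finset.mem_filter, Finset.mem_univ, true_and]
      refine and_congr_left fun hj => ⟨fun hle => lt_of_le_of_ne hle fun he => h ?_, le_of_lt⟩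
      rwa [← hq he]
    rw [greedy, faceRank, faceRank, this, sub_self]

theorem exists_injective_isLower (S : Finset E) :
    ∃ q : E → ℝ ×ₗ Fin (Fintype.card E), Function.Injective q ∧
      ∀ i ∈ S, ∀ j, q j ≤ q i → j ∈ S := by
  refine ⟨weightRank (fun i => if i ∈ S then 1 else 0) (Fintype.equivFin E),
    weightRank_injective _ (Fintype.equivFin E).injective, fun i hi j hj => ?_⟩
  by_contra hjS
  have := weight_le_of_weightRank_le hj
  simp only [hi, hjS, if_true, if_false] at this
  linarith

/-- Equality holds for a tie-breaking that ranks `S` first, as the greedy vector of `faceRank` then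
telescopes over `S`. -/
theorem isGreatest_faceRank {f : Finset E → ℝ} (hf : IsPolymatroidRank f) {w : E → ℝ}
    (hw : ∀ i, 0 ≤ w i) {c : ℝ} (hc : 0 ≤ c) (S : Finset E) :
    IsGreatest ((fun x : E → ℝ => ∑ i ∈ S, if w i = c then c * x i else 0) '' optimalFace f w)
      (faceRank f w c S) := by
  refine ⟨?_, ?_⟩
  · obtain ⟨q, hq, hqS⟩ := exists_injective_isLower S
    refine ⟨_, greedy_mem_optimalFace hf hw hq, ?_⟩
    simp only [ite_mul_greedy_weightRank f w hq]
    exact sum_greedy_of_isLower (isPolymatroidRank_faceRank hf w hc).empty hq S hqS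
  · rintro _ ⟨x, hx, rfl⟩
    exact sum_ite_le_faceRank hf hw hx hc S

end Face

/-! ### The base polytope as a hull of greedy vectors -/

section BasePolytope

variable {E : Type u} [Fintype E]

/-- Counting predecessors replaces a ranking by one with values in a fixed finite type, so there are
only finitely many to consider. -/
theorem exists_injective_lt_iff {α : Type*} [LinearOrder α] {r : E → α}
    (hr : Function.Injective r) :
    ∃ q : E → Fin (Fintype.card E), Function.Injective q ∧ ∀ i j, r i < r j ↔ q i < q j := by
  have hcard : ∀ i, (Finset.univ.filter (fun j => r j < r i)).card < Fintype.card E := fun i =>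
    Finset.card_lt_univ_of_notMem (x := i) (by simp)
  have hlt : ∀ i j, r i < r j → (Finset.univ.filter (fun k => r k < r i)).card
      < (Finset.univ.filter (fun k => r k < r j)).card := fun i j h => by
    refine Finset.card_lt_card ((Finset.ssubset_iff_of_subset ?_).2 ⟨i, by simpa using h, by simp⟩)
    exact Finset.monotone_filter_right _ fun k _ hk => hk.trans h
  have hiff : ∀ i j, r i < r j ↔ (Finset.univ.filter (fun k => r k < r i)).card
      < (Finset.univ.filter (fun k => r k < r j)).card := fun i j => by
    refine ⟨hlt i j, fun h => ?_⟩
    rcases lt_trichotomy (r i) (r j) with h' | h' | h'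
    · exact h'
    · rw [h'] at h
      exact absurd h (lt_irrefl _)
    · exact absurd h (hlt j i h').not_gt
  refine ⟨fun i => ⟨_, hcard i⟩, fun i j hij => hr ?_, fun i j => by simpa using hiff i j⟩
  have hij' := Fin.val_eq_of_eq hij
  simp only at hij'
  rcases lt_trichotomy (r i) (r j) with h | h | h
  exacts [absurd hij' (hlt i j h).ne, h, absurd hij' (hlt j i h).ne']

/-- Every point of the base polytope is a convex combination of greedy vectors. -/
theorem basePolytope_subset_convexHull [DecidableEq E] {f : Finset E → ℝ} (hf : f ∅ = 0) :
    basePolytope f ⊆ convexHull ℝ {g | ∃ q : E → Fin (Fintype.card E), Function.Injective q ∧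
      greedy f q = g} := by
  intro y hy
  have hfin : {g | ∃ q : E → Fin (Fintype.card E), Function.Injective q ∧
      greedy f q = g}.Finite :=
    (Set.toFinite {q : E → Fin (Fintype.card E) | Function.Injective q}).image (greedy f)
  by_contra hyc
  -- A separating functional is a weight vector of arbitrary signs. On the base polytope it is still
  -- maximized by the greedy vector of its own ordering, a contradiction.
  obtain ⟨φ, b, hφ, hb⟩ := geometric_hahn_banach_closed_point
    (convex_convexHull ℝ _) (hfin.isClosed_convexHull ℝ) hyc
  have hsum : ∀ z : E → ℝ, φ z = ∑ i, φ (fun j => if i = j then 1 else 0) * z i := fun z => by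
    simpa [mul_comm] using LinearMap.pi_apply_eq_sum_univ φ.toLinearMap z
  have hr := weightRank_injective (fun i => φ (fun j => if i = j then 1 else 0))
    (Fintype.equivFin E).injective
  obtain ⟨q, hq, hqr⟩ := exists_injective_lt_iff hr
  have hlt := hφ (greedy f q) (subset_convexHull ℝ _ ⟨q, hq, rfl⟩)
  rw [← greedy_congr f hqr, hsum] at hlt
  rw [hsum] at hb
  have := sum_mul_le_sum_mul_greedy hf hr
    (fun _ _ h => weight_le_of_weightRank_le h.le) hy.1.2 (Or.inr hy.2)
  linarith

end BasePolytope
-- Buckets, canonical values and the closed form of `gHat`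
section Buckets

variable {ε V : ℝ} {K : ℕ}

theorem bucket_unique (hε : 0 < ε) {j k : Fin K} {t : ℝ} (hj : t ∈ bucket ε V j)
    (hk : t ∈ bucket ε V k) : j = k := by
  have key : ∀ {j k : Fin K}, t ∈ bucket ε V j → t ∈ bucket ε V k → ¬ j < k := by
    rintro j k ⟨-, h⟩ ⟨h', -⟩ hjk
    have hjk' : (j : ℕ) + 1 ≤ k := hjk
    rcases h with h | ⟨h, -⟩
    · exact absurd (h.trans_le ((pow_le_pow_right₀ (by linarith) hjk').trans h')) (lt_irrefl _)
    · have := k.isLt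
      omega
  exact le_antisymm (not_lt.1 (key hk hj)) (not_lt.1 (key hj hk))

theorem measurableSet_bucket (k : Fin K) : MeasurableSet (bucket ε V k) := by
  refine measurableSet_Ici.inter (measurableSet_Iio.union ?_)
  exact (MeasurableSet.const _).inter (measurableSet_singleton V)

theorem measurable_canonicalValue (m : Fin K → ℝ) : Measurable (canonicalValue ε V m) :=
  Finset.measurable_sum _ fun k _ => measurable_const.indicator (measurableSet_bucket k)

theorem canonicalValue_nonneg {m : Fin K → ℝ} (hm : ∀ k, 0 < m k) (t : ℝ) :
    0 ≤ canonicalValue ε V m t :=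
  Finset.sum_nonneg fun k _ => Set.indicator_nonneg (fun _ _ => (hm k).le) _

theorem canonicalValue_of_mem_bucket (hε : 0 < ε) (m : Fin K → ℝ) {k : Fin K} {t : ℝ}
    (h : t ∈ bucket ε V k) : canonicalValue ε V m t = m k := by
  rw [canonicalValue, Finset.sum_eq_single k, Set.indicator_of_mem h]
  · exact fun j _ hj => Set.indicator_of_notMem (fun h' => hj (bucket_unique hε h' h)) _
  · simp

theorem canonicalValue_of_forall_notMem_bucket (m : Fin K → ℝ) {t : ℝ}
    (h : ∀ k : Fin K, t ∉ bucket ε V k) : canonicalValue ε V m t = 0 :=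
  Finset.sum_eq_zero fun k _ => Set.indicator_of_notMem (h k) _

/-- Positivity of `m` separates the default value 0 outside the buckets from every `m k`. -/
theorem canonicalValue_eq_iff (hε : 0 < ε) {m : Fin K → ℝ} (hm : ∀ k, 0 < m k)
    (hm' : StrictMono m) {k : Fin K} {t : ℝ} :
    canonicalValue ε V m t = m k ↔ t ∈ bucket ε V k := by
  refine ⟨fun h => ?_, canonicalValue_of_mem_bucket hε m⟩
  by_cases h' : ∃ j : Fin K, t ∈ bucket ε V j
  · obtain ⟨j, hj⟩ := h'
    rw [canonicalValue_of_mem_bucket hε m hj] at h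
    exact hm'.injective h ▸ hj
  · rw [canonicalValue_of_forall_notMem_bucket m (not_exists.1 h')] at h
    exact absurd h (hm k).ne

theorem lt_canonicalValue_iff (hε : 0 < ε) {m : Fin K → ℝ} (hm : ∀ k, 0 < m k)
    (hm' : StrictMono m) {k : Fin K} {t : ℝ} :
    m k < canonicalValue ε V m t ↔ ∃ j, k < j ∧ t ∈ bucket ε V j := by
  refine ⟨fun h => ?_, ?_⟩
  · by_cases h' : ∃ j : Fin K, t ∈ bucket ε V j
    · obtain ⟨j, hj⟩ := h'
      rw [canonicalValue_of_mem_bucket hε m hj] at h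
      exact ⟨j, hm'.lt_iff_lt.1 h, hj⟩
    · rw [canonicalValue_of_forall_notMem_bucket m (not_exists.1 h')] at h
      exact absurd h (hm k).not_gt
  · rintro ⟨j, hkj, hj⟩
    rw [canonicalValue_of_mem_bucket hε m hj]
    exact hm' hkj

theorem fakeUtility_eq {E : Type u} (hε : 0 < ε) {m : Fin K → ℝ} (hm : ∀ k, 0 < m k) (hm' : StrictMono m)
    (k : Fin K) (μ x : E → ℝ) (i : E) :
    fakeUtility ε V m k μ x i = if canonicalValue ε V m (μ i) = m k then m k * x i else 0 := by
  by_cases h : μ i ∈ bucket ε V k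
  · rw [fakeUtility, if_pos h, if_pos ((canonicalValue_eq_iff hε hm hm').2 h)]
  · rw [fakeUtility, if_neg h, if_neg (mt (canonicalValue_eq_iff hε hm hm').1 h)]

variable {E : Type u} [Fintype E]

theorem agentsIn_eq (hε : 0 < ε) {m : Fin K → ℝ} (hm : ∀ k, 0 < m k) (hm' : StrictMono m)
    (k : Fin K) (μ : E → ℝ) :
    agentsIn ε V μ k = Finset.univ.filter (fun i => canonicalValue ε V m (μ i) = m k) := by
  ext i
  simp [agentsIn, canonicalValue_eq_iff hε hm hm']

theorem agentsAbove_eq (hε : 0 < ε) {m : Fin K → ℝ} (hm : ∀ k, 0 < m k) (hm' : StrictMono m)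
    (k : Fin K) (μ : E → ℝ) :
    agentsAbove ε V μ k = Finset.univ.filter (fun i => m k < canonicalValue ε V m (μ i)) := by
  ext i
  simp [agentsAbove, lt_canonicalValue_iff hε hm hm']

variable [DecidableEq E] {f : Finset E → ℝ}

theorem isGreatest_fakeUtility (hf : IsPolymatroidRank f) (hε : 0 < ε) {m : Fin K → ℝ}
    (hm : ∀ k, 0 < m k) (hm' : StrictMono m) (k : Fin K) (μ : E → ℝ) (S : Finset E) :
    IsGreatest ((fun x : E → ℝ => ∑ i ∈ S, fakeUtility ε V m k μ x i) ''
      receiverAllocations f ε V m μ)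
      (faceRank f (fun i => canonicalValue ε V m (μ i)) (m k) S) := by
  simp only [fakeUtility_eq hε hm hm']
  exact isGreatest_faceRank hf (fun i => canonicalValue_nonneg hm _) (hm k).le S

theorem gHat_eq (hf : IsPolymatroidRank f) (hε : 0 < ε) {m : Fin K → ℝ}
    (hm : ∀ k, 0 < m k) (hm' : StrictMono m) (k : Fin K) (μ : E → ℝ) :
    gHat f ε V m k μ = faceRank f (fun i => canonicalValue ε V m (μ i)) (m k) :=
  funext fun S => (isGreatest_fakeUtility hf hε hm hm' k μ S).csSup_eq

end Buckets

/-! ### Measurability and integrability of the greedy and rank maps -/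

section Measurability

variable {Ω : Type*} [MeasurableSpace Ω] {E : Type u} [Fintype E]

theorem measurable_comp_finset (F : Finset E → ℝ) {A : Ω → Finset E}
    (hA : ∀ i, MeasurableSet {ω | i ∈ A ω}) : Measurable fun ω => F (A ω) := by
  classical
  have h : (fun ω => F (A ω)) = fun ω => ∑ B, {ω | A ω = B}.indicator (fun _ => F B) ω := by
    funext ω
    simp [Set.indicator_apply]
  rw [h]
  refine Finset.measurable_sum _ fun B _ => measurable_const.indicator ?_
  have h' : {ω | A ω = B} = ⋂ i, {ω | i ∈ A ω ↔ i ∈ B} := by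
    ext ω
    simp [Finset.ext_iff]
  rw [h']
  exact MeasurableSet.iInter fun i => (hA i).iff (MeasurableSet.const _)

variable {w : Ω → E → ℝ}

theorem measurable_greedy_weightRank {β : Type*} [LinearOrder β] (f : Finset E → ℝ)
    (hw : Measurable w) (q : E → β) : Measurable fun ω => greedy f (weightRank (w ω) q) := by
  have hwi : ∀ i, Measurable fun ω => w ω i := fun i => (measurable_pi_apply i).comp hw
  refine measurable_pi_lambda _ fun i => Measurable.sub ?_ ?_
  · refine measurable_comp_finset f fun j => ?_
    simp only [Finset.mem_filter, Finset.mem_univ, true_and, weightRank_le_iff]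
    exact (measurableSet_lt (hwi i) (hwi j)).union
      ((measurableSet_eq_fun (hwi j) (hwi i)).inter (MeasurableSet.const _))
  · refine measurable_comp_finset f fun j => ?_
    simp only [Finset.mem_filter, Finset.mem_univ, true_and, weightRank_lt_iff]
    exact (measurableSet_lt (hwi i) (hwi j)).union
      ((measurableSet_eq_fun (hwi j) (hwi i)).inter (MeasurableSet.const _))

theorem measurable_faceRank [DecidableEq E] (f : Finset E → ℝ) (hw : Measurable w) (c : ℝ)
    (S : Finset E) : Measurable fun ω => faceRank f (w ω) c S := by
  have hwi : ∀ i, Measurable fun ω => w ω i := fun i => (measurable_pi_apply i).comp hw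
  refine (Measurable.sub ?_ ?_).const_mul c
  · refine measurable_comp_finset f fun j => ?_
    simp only [Finset.mem_union, Finset.mem_inter, Finset.mem_filter, Finset.mem_univ, true_and]
    exact (measurableSet_lt measurable_const (hwi j)).union
      ((MeasurableSet.const _).inter (measurableSet_eq_fun (hwi j) measurable_const))
  · refine measurable_comp_finset f fun j => ?_
    simp only [Finset.mem_filter, Finset.mem_univ, true_and]
    exact measurableSet_lt measurable_const (hwi j)

theorem integrable_faceRank [DecidableEq E] {f : Finset E → ℝ} (hf : IsPolymatroidRank f)
    (hw : Measurable w) {c : ℝ} (hc : 0 ≤ c) (S : Finset E) (P : Measure Ω) [IsFiniteMeasure P] :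
    Integrable (fun ω => faceRank f (w ω) c S) P := by
  refine Integrable.of_bound (measurable_faceRank f hw c S).aestronglyMeasurable
    (c * f Finset.univ) (Filter.Eventually.of_forall fun ω => ?_)
  rw [Real.norm_of_nonneg ((isPolymatroidRank_faceRank hf _ hc).nonneg S), faceRank]
  refine mul_le_mul_of_nonneg_left ?_ hc
  have h1 := hf.mono (Finset.univ.filter (fun i => c < w ω i) ∪
    (S ∩ Finset.univ.filter (fun i => w ω i = c))) _ (Finset.subset_univ _)
  linarith [hf.nonneg (Finset.univ.filter (fun i => c < w ω i))]

end Measurability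

/-! ### Posterior means -/

namespace MappingRule

variable {E : Type u} (Δ : MappingRule.{u, v} E) (D : E → Measure ℝ)

theorem measurable_posteriorMean [∀ i, IsFiniteMeasure (D i)] :
    Measurable (Δ.posteriorMean D) := by
  refine measurable_pi_lambda _ fun i => ?_
  have h : StronglyMeasurable fun s => ∫ t, t ∂(posterior (Δ.kernel i) (D i) s) :=
    StronglyMeasurable.integral_kernel stronglyMeasurable_id
  exact h.measurable.comp (measurable_pi_apply i)

variable [Fintype E] [∀ i, IsProbabilityMeasure (D i)]

instance isProbabilityMeasure_signalLaw : IsProbabilityMeasure (Δ.signalLaw D) := by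
  unfold signalLaw
  infer_instance

theorem ae_posteriorMean_mem_Icc {a b : ℝ} (hD : ∀ i, ∀ᵐ t ∂(D i), t ∈ Set.Icc a b) :
    ∀ᵐ σ ∂(Δ.signalLaw D), ∀ i, Δ.posteriorMean D σ i ∈ Set.Icc a b := by
  refine ae_all_iff.2 fun i => ?_
  have h1 : ∀ᵐ s ∂((D i).bind (Δ.kernel i)),
      ∀ᵐ t ∂(posterior (Δ.kernel i) (D i) s), t ∈ Set.Icc a b := by
    refine Measure.ae_ae_of_ae_comp ?_
    -- Averaged over the signals, the posterior is the prior, so the support of `D i` passes to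
    -- almost every posterior.
    rw [posterior_comp_self]
    exact hD i
  have h2 : ∀ᵐ s ∂((D i).bind (Δ.kernel i)),
      ∫ t, t ∂(posterior (Δ.kernel i) (D i) s) ∈ Set.Icc a b := by
    filter_upwards [h1] with s hs
    exact (convex_Icc a b).integral_mem isClosed_Icc hs
      (Integrable.of_mem_Icc a b aemeasurable_id hs)
  exact (Measure.quasiMeasurePreserving_eval
    (μ := fun i => (D i).bind (Δ.kernel i)) i).ae h2

end MappingRule
-- Convexity of the face and linearity of fake utility
theorem convex_optimalFace {E : Type u} [Fintype E] (f : Finset E → ℝ) (w : E → ℝ) :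
    Convex ℝ (optimalFace f w) := by
  rintro x ⟨⟨hx0, hxf⟩, hx⟩ y ⟨⟨hy0, hyf⟩, hy⟩ a b ha hb hab
  refine ⟨⟨fun i => ?_, fun A => ?_⟩, fun z hz => ?_⟩
  · exact add_nonneg (mul_nonneg ha (hx0 i)) (mul_nonneg hb (hy0 i))
  · have h : ∑ i ∈ A, (a • x + b • y) i = a * ∑ i ∈ A, x i + b * ∑ i ∈ A, y i := by
      simp [Finset.sum_add_distrib, Finset.mul_sum]
    rw [h]
    calc a * ∑ i ∈ A, x i + b * ∑ i ∈ A, y i ≤ a * f A + b * f A :=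
          add_le_add (mul_le_mul_of_nonneg_left (hxf A) ha) (mul_le_mul_of_nonneg_left (hyf A) hb)
      _ = f A := by rw [← add_mul, hab, one_mul]
  · have h : ∑ i, w i * (a • x + b • y) i = a * ∑ i, w i * x i + b * ∑ i, w i * y i := by
      simp [Finset.sum_add_distrib, Finset.mul_sum, mul_add, mul_left_comm]
    rw [h]
    calc ∑ i, w i * z i = a * ∑ i, w i * z i + b * ∑ i, w i * z i := by
          rw [← add_mul, hab, one_mul]
      _ ≤ _ := add_le_add (mul_le_mul_of_nonneg_left (hx z hz) ha)
          (mul_le_mul_of_nonneg_left (hy z hz) hb)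

section FakeUtility

variable {E : Type u} {ε V : ℝ} {K : ℕ} {m : Fin K → ℝ}

theorem fakeUtility_nonneg (hm : ∀ k, 0 < m k) (k : Fin K) (μ : E → ℝ) {x : E → ℝ}
    {i : E} (hx : 0 ≤ x i) : 0 ≤ fakeUtility ε V m k μ x i := by
  unfold fakeUtility
  split_ifs
  exacts [mul_nonneg (hm k).le hx, le_rfl]

theorem fakeUtility_le (hm : ∀ k, 0 < m k) (k : Fin K) (μ : E → ℝ) {x : E → ℝ}
    {i : E} {c : ℝ} (hc : 0 ≤ c) (hx : x i ≤ c) : fakeUtility ε V m k μ x i ≤ m k * c := by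
  unfold fakeUtility
  split_ifs
  exacts [mul_le_mul_of_nonneg_left hx (hm k).le, mul_nonneg (hm k).le hc]

theorem fakeUtility_combination (k : Fin K) (μ x y : E → ℝ) (a b : ℝ) (i : E) :
    fakeUtility ε V m k μ (a • x + b • y) i
      = a * fakeUtility ε V m k μ x i + b * fakeUtility ε V m k μ y i := by
  unfold fakeUtility
  split_ifs
  · simp only [Pi.add_apply, Pi.smul_apply, smul_eq_mul]
    ring
  · ring

end FakeUtility

theorem MappingRule.measurable_canonicalValue_posteriorMean {E : Type u} (Δ : MappingRule.{u, v} E) {ε V : ℝ} {K : ℕ}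
    (m : Fin K → ℝ) (D : E → Measure ℝ) [∀ i, IsProbabilityMeasure (D i)] :
    Measurable fun σ => fun i => canonicalValue ε V m (Δ.posteriorMean D σ i) :=
  measurable_pi_lambda _ fun i => (measurable_canonicalValue m).comp
    ((measurable_pi_apply i).comp (Δ.measurable_posteriorMean D))

/-! ### Selection rules and the two inclusions -/

section Selection

variable {E : Type u} [Fintype E] [DecidableEq E] {f : Finset E → ℝ} {ε V : ℝ} {K : ℕ} {m : Fin K → ℝ}
  {D : E → Measure ℝ} [∀ i, IsProbabilityMeasure (D i)]

theorem MappingRule.IsSelectionRule.integrable_fakeUtility {Δ : MappingRule.{u, v} E}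
    (hf : IsPolymatroidRank f) (hm : ∀ k, 0 < m k) {x : (∀ i, Δ.Signal i) → E → ℝ}
    (hx : Δ.IsSelectionRule D f ε V m x) (k : Fin K) (i : E) :
    Integrable (fun σ => fakeUtility ε V m k (Δ.posteriorMean D σ) (x σ) i) (Δ.signalLaw D) := by
  have hmeas : Measurable fun σ => fakeUtility ε V m k (Δ.posteriorMean D σ) (x σ) i := by
    refine Measurable.ite ?_ (((measurable_pi_apply i).comp hx.1).const_mul _) measurable_const
    exact ((measurable_pi_apply i).comp (Δ.measurable_posteriorMean D)) (measurableSet_bucket k)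
  refine Integrable.of_bound hmeas.aestronglyMeasurable (m k * f {i}) ?_
  filter_upwards [hx.2] with σ hσ
  rw [Real.norm_of_nonneg (fakeUtility_nonneg hm k _ (hσ.1.1 i))]
  exact fakeUtility_le hm k _ (hf.nonneg _) (by simpa using hσ.1.2 {i})

theorem MappingRule.isSelectionRule_greedy {β : Type*} [LinearOrder β]
    (Δ : MappingRule.{u, v} E) (hf : IsPolymatroidRank f) (hm : ∀ k, 0 < m k) {q : E → β}
    (hq : Function.Injective q) :
    Δ.IsSelectionRule D f ε V m fun σ =>
      greedy f (weightRank (fun i => canonicalValue ε V m (Δ.posteriorMean D σ i)) q) :=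
  ⟨measurable_greedy_weightRank f (Δ.measurable_canonicalValue_posteriorMean m D) q,
    Filter.Eventually.of_forall fun _ =>
      greedy_mem_optimalFace hf (fun _ => canonicalValue_nonneg hm _) hq⟩

variable {Δ : Fin K → MappingRule.{u, v} E}

theorem convex_achievableFakeUtilities (hf : IsPolymatroidRank f) (hm : ∀ k, 0 < m k) :
    Convex ℝ (achievableFakeUtilities Δ D f ε V m) := by
  rintro _ ⟨x, hx, rfl⟩ _ ⟨y, hy, rfl⟩ a b ha hb hab
  refine ⟨fun k σ => a • x k σ + b • y k σ, fun k => ⟨?_, ?_⟩, ?_⟩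
  · exact ((hx k).1.const_smul a).add ((hy k).1.const_smul b)
  · filter_upwards [(hx k).2, (hy k).2] with σ h1 h2
    exact convex_optimalFace _ _ h1 h2 ha hb hab
  · funext i
    simp only [expectedFakeUtility, Pi.add_apply, Pi.smul_apply, smul_eq_mul,
      fakeUtility_combination]
    rw [mul_left_comm a, mul_left_comm b, ← mul_add, Finset.mul_sum, Finset.mul_sum,
      ← Finset.sum_add_distrib]
    congr 1
    refine Finset.sum_congr rfl fun k _ => ?_
    rw [integral_add (((hx k).integrable_fakeUtility hf hm k i).const_mul a)
      (((hy k).integrable_fakeUtility hf hm k i).const_mul b), integral_const_mul,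
      integral_const_mul]

theorem integrable_gHat (hf : IsPolymatroidRank f) (hε : 0 < ε) (hm : ∀ k, 0 < m k)
    (hm' : StrictMono m) (Δ : MappingRule.{u, v} E) (k : Fin K) (S : Finset E) :
    Integrable (fun σ => gHat f ε V m k (Δ.posteriorMean D σ) S) (Δ.signalLaw D) := by
  simp only [gHat_eq hf hε hm hm']
  exact integrable_faceRank hf (Δ.measurable_canonicalValue_posteriorMean m D) (hm k).le S _

theorem isPolymatroidRank_gHat (hf : IsPolymatroidRank f) (hε : 0 < ε) (hm : ∀ k, 0 < m k)
    (hm' : StrictMono m) (k : Fin K) (μ : E → ℝ) : IsPolymatroidRank (gHat f ε V m k μ) := by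
  rw [gHat_eq hf hε hm hm']
  exact isPolymatroidRank_faceRank hf _ (hm k).le

theorem isPolymatroidRank_rankHat (hf : IsPolymatroidRank f) (hε : 0 < ε) (hm : ∀ k, 0 < m k)
    (hm' : StrictMono m) : IsPolymatroidRank (rankHat Δ D f ε V m) := by
  have hg := fun k μ => isPolymatroidRank_gHat (V := V) hf hε hm hm' k μ
  have hi := fun k S => integrable_gHat (V := V) (D := D) hf hε hm hm' (Δ k) k S
  have hK : (0 : ℝ) ≤ 1 / K := by positivity
  refine ⟨fun A => ?_, ?_, fun A B h => ?_, fun A B => ?_⟩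
  · exact mul_nonneg hK (Finset.sum_nonneg fun k _ => integral_nonneg fun σ => (hg k _).nonneg A)
  · simp [rankHat, (hg _ _).empty]
  · exact mul_le_mul_of_nonneg_left (Finset.sum_le_sum fun k _ =>
      integral_mono (hi k A) (hi k B) fun σ => (hg k _).mono A B h) hK
  · simp only [rankHat]
    rw [← mul_add, ← mul_add, ← Finset.sum_add_distrib, ← Finset.sum_add_distrib]
    refine mul_le_mul_of_nonneg_left (Finset.sum_le_sum fun k _ => ?_) hK
    rw [← integral_add (hi k _) (hi k _), ← integral_add (hi k _) (hi k _)]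
    exact integral_mono ((hi k _).add (hi k _)) ((hi k _).add (hi k _))
      fun σ => (hg k _).submodular A B

theorem achievableFakeUtilities_subset (hf : IsPolymatroidRank f) (hε : 0 < ε)
    (hm : ∀ k, 0 < m k) (hm' : StrictMono m) :
    achievableFakeUtilities Δ D f ε V m ⊆ independencePolytope (rankHat Δ D f ε V m) := by
  rintro _ ⟨x, hx, rfl⟩
  have hK : (0 : ℝ) ≤ 1 / K := by positivity
  refine ⟨fun i => mul_nonneg hK (Finset.sum_nonneg fun k _ => integral_nonneg_of_ae ?_),
    fun A => ?_⟩
  · filter_upwards [(hx k).2] with σ hσ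
    exact fakeUtility_nonneg hm k _ (hσ.1.1 i)
  · simp only [expectedFakeUtility, rankHat]
    rw [← Finset.mul_sum, Finset.sum_comm (s := A)]
    refine mul_le_mul_of_nonneg_left (Finset.sum_le_sum fun k _ => ?_) hK
    rw [← integral_finsetSum A fun i _ => (hx k).integrable_fakeUtility hf hm k i]
    refine integral_mono_ae (integrable_finsetSum A fun i _ =>
      (hx k).integrable_fakeUtility hf hm k i) (integrable_gHat hf hε hm hm' (Δ k) k A) ?_
    filter_upwards [(hx k).2] with σ hσ
    rw [gHat_eq hf hε hm hm']
    exact (isGreatest_fakeUtility hf hε hm hm' k _ A).2 ⟨x k σ, hσ, rfl⟩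

/-- The order `q` is the same for every signal profile and every bucket, so taking marginals along
it commutes with expectation and averaging. -/
theorem greedy_rankHat_mem_achievableFakeUtilities {β : Type*} [LinearOrder β]
    (hf : IsPolymatroidRank f) (hε : 0 < ε) (hm : ∀ k, 0 < m k) (hm' : StrictMono m)
    {q : E → β} (hq : Function.Injective q) :
    greedy (rankHat Δ D f ε V m) q ∈ achievableFakeUtilities Δ D f ε V m := by
  refine ⟨_, fun k => (Δ k).isSelectionRule_greedy hf hm hq, ?_⟩
  funext i
  simp only [expectedFakeUtility, greedy.eq_1 (rankHat Δ D f ε V m), rankHat]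
  rw [← mul_sub, ← Finset.sum_sub_distrib]
  congr 1
  refine Finset.sum_congr rfl fun k _ => ?_
  rw [← integral_sub (integrable_gHat hf hε hm hm' (Δ k) k _)
    (integrable_gHat hf hε hm hm' (Δ k) k _)]
  simp only [fakeUtility_eq hε hm hm', gHat_eq hf hε hm hm']
  exact integral_congr_ae (Filter.Eventually.of_forall fun σ =>
    (ite_mul_greedy_weightRank f _ hq (m k) i).symm)

theorem basePolytope_subset_achievableFakeUtilities (hf : IsPolymatroidRank f) (hε : 0 < ε)
    (hm : ∀ k, 0 < m k) (hm' : StrictMono m) :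
    basePolytope (rankHat Δ D f ε V m) ⊆ achievableFakeUtilities Δ D f ε V m := by
  refine (basePolytope_subset_convexHull (isPolymatroidRank_rankHat hf hε hm hm').empty).trans
    (convexHull_min ?_ (convex_achievableFakeUtilities hf hm))
  rintro _ ⟨q, hq, rfl⟩
  exact greedy_rankHat_mem_achievableFakeUtilities hf hε hm hm' hq

end Selection
end Persuasion

theorem mainTheorem6 {E : Type u} [Fintype E] [DecidableEq E]
    (f : Finset E → ℝ) (hf : Persuasion.IsPolymatroidRank f)
    (ε V : ℝ) (hε : 0 < ε) (K : ℕ) (hK : 0 < K) (hV : V = (1 + ε) ^ K)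
    (m : Fin K → ℝ) (hm_pos : ∀ k, 0 < m k) (hm_mono : StrictMono m)
    (D : E → Measure ℝ) [∀ i, IsProbabilityMeasure (D i)]
    (hD : ∀ i, ∀ᵐ t ∂(D i), t ∈ Set.Icc 1 V)
    (Δ : Fin K → Persuasion.MappingRule.{u, v} E) :
    -- for fixed posterior means: the maximum is attained, has a closed form, is a rank function
    (∀ (k : Fin K) (μ : E → ℝ), (∀ i, μ i ∈ Set.Icc 1 V) →
      (∀ S : Finset E,
        IsGreatest ((fun x : E → ℝ => ∑ i ∈ S, Persuasion.fakeUtility ε V m k μ x i) ''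
          Persuasion.receiverAllocations f ε V m μ) (Persuasion.gHat f ε V m k μ S) ∧
        Persuasion.gHat f ε V m k μ S =
          m k * (f (Persuasion.agentsAbove ε V μ k ∪ (S ∩ Persuasion.agentsIn ε V μ k))
            - f (Persuasion.agentsAbove ε V μ k))) ∧
      Persuasion.IsPolymatroidRank (Persuasion.gHat f ε V m k μ)) ∧
    -- all expectations involved exist
    (∀ k, ∀ᵐ σ ∂((Δ k).signalLaw D), ∀ i, (Δ k).posteriorMean D σ i ∈ Set.Icc 1 V) ∧
    (∀ (k : Fin K) (S : Finset E),
      Integrable (fun σ => Persuasion.gHat f ε V m k ((Δ k).posteriorMean D σ) S)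
        ((Δ k).signalLaw D)) ∧
    (∀ (k : Fin K) (x : (∀ i, (Δ k).Signal i) → E → ℝ),
      (Δ k).IsSelectionRule D f ε V m x → ∀ i,
        Integrable (fun σ =>
          Persuasion.fakeUtility ε V m k ((Δ k).posteriorMean D σ) (x σ) i)
          ((Δ k).signalLaw D)) ∧
    -- the polymatroid and the two inclusions
    Persuasion.IsPolymatroidRank (Persuasion.rankHat Δ D f ε V m) ∧
    Persuasion.achievableFakeUtilities Δ D f ε V m ⊆
      Persuasion.independencePolytope (Persuasion.rankHat Δ D f ε V m) ∧
    Persuasion.basePolytope (Persuasion.rankHat Δ D f ε V m) ⊆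
      Persuasion.achievableFakeUtilities Δ D f ε V m := by

  refine ⟨fun k μ _ => ⟨fun S => ⟨?_, ?_⟩, ?_⟩, fun k => ?_, fun k S => ?_, fun k x hx i => ?_,
    ?_, ?_, ?_⟩
  · rw [Persuasion.gHat_eq hf hε hm_pos hm_mono]
    exact Persuasion.isGreatest_fakeUtility hf hε hm_pos hm_mono k μ S
  · rw [Persuasion.gHat_eq hf hε hm_pos hm_mono, Persuasion.faceRank,
      Persuasion.agentsAbove_eq hε hm_pos hm_mono, Persuasion.agentsIn_eq hε hm_pos hm_mono]
  · exact Persuasion.isPolymatroidRank_gHat hf hε hm_pos hm_mono k μ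
  · exact (Δ k).ae_posteriorMean_mem_Icc D hD
  · exact Persuasion.integrable_gHat hf hε hm_pos hm_mono (Δ k) k S
  · exact hx.integrable_fakeUtility hf hm_pos k i
  · exact Persuasion.isPolymatroidRank_rankHat hf hε hm_pos hm_mono
  · exact Persuasion.achievableFakeUtilities_subset hf hε hm_pos hm_mono
  · exact Persuasion.basePolytope_subset_achievableFakeUtilities hf hε hm_pos hm_mono
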